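/- Let $\mathbb T^3=(\mathbb R/2\pi\mathbb Z)^3$ be the flat torus with coordinates $(x_1,x_2,x_3)$, and let $\mathbb{ST}^3=\mathbb T^3\times\mathbb S^2$ be its unit sphere bundle, where $\mathbb S^2\subset\mathbb R^3$ is the unit sphere. Consider the vector fields on $\mathbb T^3$ $$X_0(x)=(\cos x_3,\ \sin x_3,\ 1),\qquad X_k(x)=(0,\ 0,\ B_k(x_1,x_2)),\quad k=1,\dots,5,$$ with $B_1=1$, $B_2=\sin x_1$, $B_3=\cos x_1$, $B_4=\sin x_2$, $B_5=\cos x_2$; they are the drift and the noise fields of the charged-particle SDE $dx_t=X_0(x_t)\,dt+\sqrt{\epsilon}\sum_{k=1}^5X_k(x_t)\circ dW^k_t$, $\epsilon>0$. For $k=0,\dots,5$ let $$\tilde X_k(x,z)=\bigl(X_k(x),\ (1-z\otimes z)\,\nabla X_k(x)\,z\bigr),\qquad (x,z)\in\mathbb{ST}^3,$$ be the lifted vector fields on $\mathbb{ST}^3$, which drive the associated projective process, and let $\mathcal F=\tilde X_0+\operatorname{span}\{\tilde X_1,\dots,\tilde X_5\}$ (a family that does not depend on $\epsilon>0$). A continuous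 curve $\eta:[0,t]\to\mathbb{ST}^3$ is an integral curve of $\mathcal F$ if there are a partition $0=t_0<t_1<\dots<t_m=t$ and vector fields $V_1,\dots,V_m\in\mathcal F$ such that $\dot\eta(s)=V_i(\eta(s))$ for $t_{i-1}<s<t_i$, $i=1,\dots,m$. Let $\mathcal A_{\mathcal F}(w,t)$ be the set of all endpoints $\eta(t)$ of integral curves $\eta:[0,t]\to\mathbb{ST}^3$ of $\mathcal F$ with $\eta(0)=w$. Then the control system is approximately controllable at a fixed time: there exists $T'>0$ such that $$\overline{\mathcal A_{\mathcal F}(w,T')}=\mathbb{ST}^3\qquad\text{for all } w\in\mathbb{ST}^3.$$ -/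

import Mathlib

namespace ChargedParticle

noncomputable section

/-- Euclidean three-space, the tangent space of the flat torus at every point. -/
abbrev E3 : Type := EuclideanSpace ℝ (Fin 3)

/-- The flat torus `(ℝ / 2πℤ)³`. -/
abbrev T3 : Type := Fin 3 → Real.Angle

/-- The unit sphere bundle of the flat torus, `T³ × S²`, with its product topology. -/
abbrev ST3 : Type := T3 × Metric.sphere (0 : E3) 1

/-- The covering map `ℝ³ → T³`. -/
def toTorus (y : E3) : T3 := fun i => ((y i : ℝ) : Real.Angle)

/-- The drift field `(cos x₃, sin x₃, 1)`; the coordinates are numbered `0, 1, 2`. -/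
def drift (x : T3) : E3 := !₂[(x 2).cos, (x 2).sin, 1]

/-- The five modes `1, sin x₁, cos x₁, sin x₂, cos x₂` of the magnetic field. -/
def mode (k : Fin 5) (x : T3) : ℝ :=
  ![1, (x 0).sin, (x 0).cos, (x 1).sin, (x 1).cos] k

/-- The diffusion fields `(0, 0, B_k(x₁, x₂))`. -/
def diffusion (k : Fin 5) (x : T3) : E3 := !₂[0, 0, mode k x]

/-- The (flat) covariant derivative `∇X(x)` of a vector field on the torus. -/
def nabla (X : T3 → E3) (x : T3) : E3 →L[ℝ] E3 :=
  fderiv ℝ (fun y : E3 => X (x + toTorus y)) 0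

/-- The lift of a vector field on the torus to the sphere bundle,
`(x, z) ↦ (X(x), (1 - z ⊗ z) ∇X(x) z)`, with values in `ℝ³ × ℝ³`. -/
def projectiveLift (X : T3 → E3) (w : ST3) : E3 × E3 :=
  (X w.1, nabla X w.1 w.2 - inner ℝ (w.2 : E3) (nabla X w.1 w.2) • (w.2 : E3))

/-- The family `Y₀ + span {Y₁, …, Y_r}` of vector fields. -/
def affineFamily {ι : Type} (Y₀ : ST3 → E3 × E3) (Y : ι → ST3 → E3 × E3) :
    Set (ST3 → E3 × E3) :=
  {V | ∃ U ∈ Submodule.span ℝ (Set.range Y), V = Y₀ + U}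

/-- The curve `η` in `T³ × S²` is differentiable at `s` with velocity `u`. The torus component
is differentiated through a local lift to `ℝ³`, the spherical one in the ambient `ℝ³`. -/
def HasVelocityAt (η : ℝ → ST3) (u : E3 × E3) (s : ℝ) : Prop :=
  (∃ ξ : ℝ → E3, (∀ᶠ r in nhds s, toTorus (ξ r) = (η r).1) ∧ HasDerivAt ξ u.1 s) ∧
    HasDerivAt (fun r => ((η r).2 : E3)) u.2 s

/-- `η` restricted to `[0, t]` is an integral curve of the family `F`: it is continuous, and
there are a partition `0 = t₀ < t₁ < … < t_m = t` and fields `V₁, …, V_m` in `F` such that `η`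
solves `η' = V_i(η)` on the `i`-th open interval of the partition. -/
def IsIntegralCurve (F : Set (ST3 → E3 × E3)) (η : ℝ → ST3) (t : ℝ) : Prop :=
  ContinuousOn η (Set.Icc 0 t) ∧
    ∃ (m : ℕ) (τ : Fin (m + 1) → ℝ) (V : Fin m → ST3 → E3 × E3),
      StrictMono τ ∧ τ 0 = 0 ∧ τ (Fin.last m) = t ∧
        ∀ i : Fin m, V i ∈ F ∧
          ∀ s ∈ Set.Ioo (τ i.castSucc) (τ i.succ), HasVelocityAt η (V i (η s)) s

/-- The set of points reached at time exactly `t` by integral curves of `F` from `w`. -/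
def reachableSet (F : Set (ST3 → E3 × E3)) (w : ST3) (t : ℝ) : Set ST3 :=
  {z | ∃ η : ℝ → ST3, IsIntegralCurve F η t ∧ η 0 = w ∧ η t = z}

/-- The control family `X̃₀ + span {X̃₁, …, X̃₅}` of the projective process. -/
def controlFamily : Set (ST3 → E3 × E3) :=
  affineFamily (projectiveLift drift) (fun k : Fin 5 => projectiveLift (diffusion k))

end

end ChargedParticle

namespace ChargedParticle

noncomputable section

/-! The spherical part of the lifted system is the normalized solution of the linearized equation,
so it suffices to steer pairs (position in the cover, nonzero tangent vector) by piecewise constant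
controls. A uniform field bends the horizontal motion into circles (`path_arc`) or cancels the
turning (`path_straight`). The sinusoidal modes can instead cancel the turning only along a
coordinate line while keeping a unit gradient there; the tangent vector then rotates in a coordinate
plane (`path_rotate_first`, `path_rotate_second`). Combining these turns any direction into the
first axis in bounded time. Uniform fields fix that axis, so the position can then be steered freely
in any prescribed large time (`path_axis`). A time-reversal symmetry (`Path.reverse`) leads from the
axis to an arbitrary target. The reachable set at time 100 is thus the whole bundle, even before
taking the closure. -/

/-- The magnetic field strength with coefficients `u` at a point of `ℝ³`. -/
def field (u : Fin 5 → ℝ) (y : E3) : ℝ :=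
  u 0 + u 1 * Real.sin (y 0) + u 2 * Real.cos (y 0) + u 3 * Real.sin (y 1) + u 4 * Real.cos (y 1)

/-- The velocity of the lifted particle with control `u`. -/
def velocity (u : Fin 5 → ℝ) (y : E3) : E3 :=
  !₂[Real.cos (y 2), Real.sin (y 2), 1 + field u y]

/-- The linearization of `velocity u` at `y` applied to `v`. -/
def variation (u : Fin 5 → ℝ) (y v : E3) : E3 :=
  !₂[-Real.sin (y 2) * v 2, Real.cos (y 2) * v 2,
    (u 1 * Real.cos (y 0) - u 2 * Real.sin (y 0)) * v 0 +
      (u 3 * Real.cos (y 1) - u 4 * Real.sin (y 1)) * v 1]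

/-! ### The control fields in covering coordinates -/

theorem hasDerivAt_e3 {f : ℝ → E3} {f' : E3} {s : ℝ} :
    HasDerivAt f f' s ↔ HasDerivAt (fun r => f r 0) (f' 0) s ∧ HasDerivAt (fun r => f r 1) (f' 1) s
      ∧ HasDerivAt (fun r => f r 2) (f' 2) s := by
  rw [hasDerivAt_iff_hasFDerivAt, ← hasFDerivWithinAt_univ, hasFDerivWithinAt_euclidean,
    Fin.forall_fin_succ, Fin.forall_fin_succ, Fin.forall_fin_one]
  simp only [hasFDerivWithinAt_univ, hasDerivAt_iff_hasFDerivAt]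
  refine Iff.of_eq ?_
  congr!

theorem toTorus_add (y y' : E3) : toTorus (y + y') = toTorus y + toTorus y' := by
  ext i; simp [toTorus]

theorem nabla_apply {X : T3 → E3} {y z : E3} {u : E3}
    (hd : DifferentiableAt ℝ (fun y' : E3 => X (toTorus y')) y)
    (h : HasDerivAt (fun s : ℝ => X (toTorus (y + s • z))) u 0) :
    nabla X (toTorus y) z = u := by
  have hd' : DifferentiableAt ℝ (fun y' : E3 => X (toTorus y + toTorus y')) 0 := by
    simp only [← toTorus_add]
    have : DifferentiableAt ℝ (fun y' : E3 => X (toTorus y')) (y + 0) := by simpa using hd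
    exact this.comp (0 : E3) (by fun_prop)
  have h2 : HasDerivAt (fun s : ℝ => s • z) z 0 := by
    simpa using (hasDerivAt_id (0 : ℝ)).smul_const z
  have h1 := hd'.hasFDerivAt
  rw [show (0 : E3) = (0 : ℝ) • z by simp] at h1
  have h3 := h1.comp_hasDerivAt (0 : ℝ) h2
  simp only [zero_smul] at h3
  refine h3.unique ?_
  simpa [Function.comp_def, toTorus_add] using h

theorem drift_toTorus (y : E3) :
    drift (toTorus y) = !₂[Real.cos (y 2), Real.sin (y 2), 1] := by
  simp [drift, toTorus]

theorem mode_toTorus (k : Fin 5) (y : E3) : mode k (toTorus y) =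
    ![1, Real.sin (y 0), Real.cos (y 0), Real.sin (y 1), Real.cos (y 1)] k := by
  simp [mode, toTorus]

theorem hasDerivAt_coord (y z : E3) (i : Fin 3) :
    HasDerivAt (fun s : ℝ => (y + s • z) i) (z i) 0 := by
  simpa using ((hasDerivAt_id (0 : ℝ)).mul_const (z i)).const_add (y i)

theorem nabla_drift (y z : E3) :
    nabla drift (toTorus y) z = !₂[-Real.sin (y 2) * z 2, Real.cos (y 2) * z 2, 0] := by
  apply nabla_apply
  · simp only [drift_toTorus]
    rw [differentiableAt_euclidean]
    intro i; fin_cases i <;> simp <;> fun_prop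
  · simp only [drift_toTorus]
    rw [hasDerivAt_e3]
    refine ⟨?_, ?_, ?_⟩
    · simpa using (hasDerivAt_coord y z 2).cos
    · simpa using (hasDerivAt_coord y z 2).sin
    · simpa using hasDerivAt_const (0 : ℝ) (1 : ℝ)

theorem nabla_diffusion (k : Fin 5) (y z : E3) :
    nabla (diffusion k) (toTorus y) z =
      !₂[0, 0, ![0, Real.cos (y 0) * z 0, -Real.sin (y 0) * z 0,
        Real.cos (y 1) * z 1, -Real.sin (y 1) * z 1] k] := by
  apply nabla_apply
  · simp only [diffusion, mode_toTorus]
    rw [differentiableAt_euclidean]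
    intro i; fin_cases i <;> fin_cases k <;> simp <;> fun_prop
  · simp only [diffusion, mode_toTorus]
    rw [hasDerivAt_e3]
    refine ⟨by simpa using hasDerivAt_const (0 : ℝ) (0 : ℝ),
      by simpa using hasDerivAt_const (0 : ℝ) (0 : ℝ), ?_⟩
    fin_cases k
    · simpa using hasDerivAt_const (0 : ℝ) (1 : ℝ)
    · simpa using (hasDerivAt_coord y z 0).sin
    · simpa using (hasDerivAt_coord y z 0).cos
    · simpa using (hasDerivAt_coord y z 1).sin
    · simpa using (hasDerivAt_coord y z 1).cos

/-- The member of the control family with coefficients `u`. -/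
def controlledField (u : Fin 5 → ℝ) : ST3 → E3 × E3 :=
  projectiveLift drift + ∑ k, u k • projectiveLift (diffusion k)

theorem controlledField_mem (u : Fin 5 → ℝ) : controlledField u ∈ controlFamily :=
  ⟨_, Submodule.sum_mem _ fun k _ =>
    Submodule.smul_mem _ _ (Submodule.subset_span ⟨k, rfl⟩), rfl⟩

theorem controlledField_apply (u : Fin 5 → ℝ) (y : E3) (z : Metric.sphere (0 : E3) 1) :
    controlledField u (toTorus y, z) =
      (velocity u y, variation u y z - inner ℝ (z : E3) (variation u y z) • (z : E3)) := by
  have hv : velocity u y = drift (toTorus y) + ∑ k, u k • diffusion k (toTorus y) := by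
    ext i
    fin_cases i <;>
      simp [velocity, field, drift_toTorus, diffusion, mode_toTorus, Fin.sum_univ_succ]
    ring
  have hw : variation u y z = nabla drift (toTorus y) z +
      ∑ k, u k • nabla (diffusion k) (toTorus y) z := by
    ext i
    fin_cases i <;> simp [variation, nabla_drift, nabla_diffusion, Fin.sum_univ_succ]
    ring
  ext1
  · simp [controlledField, projectiveLift, hv, Prod.fst_sum]
  · simp only [controlledField, projectiveLift, hw, Pi.add_apply, Finset.sum_apply, Pi.smul_apply,
      Prod.snd_add, Prod.snd_sum, Prod.smul_snd, inner_add_right, inner_sum, inner_smul_right,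
      add_smul, smul_sub, Finset.sum_sub_distrib, Finset.sum_smul, mul_smul]
    abel

/-! ### Normalizing the linearized flow -/

/-- The direction of a vector, with an arbitrary value at zero. -/
def direction (v : E3) : Metric.sphere (0 : E3) 1 :=
  if h : v = 0 then ⟨EuclideanSpace.single 0 1, by simp⟩
  else ⟨‖v‖⁻¹ • v, by simp [norm_smul, h]⟩

theorem direction_coe {v : E3} (h : v ≠ 0) : (direction v : E3) = ‖v‖⁻¹ • v := by
  simp [direction, h]

theorem direction_of_sphere (z : Metric.sphere (0 : E3) 1) : direction (z : E3) = z := by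
  have hz : ‖(z : E3)‖ = 1 := by simp
  have h : (z : E3) ≠ 0 := by rw [← norm_ne_zero_iff, hz]; exact one_ne_zero
  ext1
  rw [direction_coe h, hz, inv_one, one_smul]

theorem direction_smul {c : ℝ} (hc : 0 < c) (v : E3) : direction (c • v) = direction v := by
  by_cases h : v = 0
  · simp [h]
  · ext1
    rw [direction_coe h, direction_coe (smul_ne_zero hc.ne' h), norm_smul, Real.norm_of_nonneg hc.le,
      smul_smul]
    congr 1
    field_simp

theorem hasDerivAt_direction {v : ℝ → E3} {v' : E3} {s : ℝ} (h0 : ∀ r, v r ≠ 0)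
    (h : HasDerivAt v v' s) :
    HasDerivAt (fun r => (direction (v r) : E3))
      (‖v s‖⁻¹ • v' - inner ℝ (direction (v s) : E3) (‖v s‖⁻¹ • v') • (direction (v s) : E3)) s := by
  simp only [fun r => direction_coe (h0 r)]
  have hn : HasDerivAt (fun r => ‖v r‖) (inner ℝ (v s) v' / ‖v s‖) s := by
    have h1 := (h.norm_sq).sqrt (by simpa using h0 s)
    simp only [norm_nonneg, Real.sqrt_sq] at h1
    convert h1 using 1
    field_simp
  have hpos : ‖v s‖ ≠ 0 := by simpa using h0 s
  refine ((hn.inv hpos).smul h).congr_deriv ?_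
  simp only [inner_smul_left, inner_smul_right, smul_smul, Pi.inv_apply]
  rw [sub_eq_add_neg, ← neg_smul]
  congr 2
  simp
  field_simp

/-- The point of the sphere bundle with lifted position `y` and direction `v`. -/
def state (y v : E3) : ST3 := (toTorus y, direction v)

/-- `(y, v)` is a solution of the lifted linearized system with constant control `u`. -/
def IsTrajectory (u : Fin 5 → ℝ) (y v : ℝ → E3) : Prop :=
  ∀ s, v s ≠ 0 ∧ HasDerivAt y (velocity u (y s)) s ∧ HasDerivAt v (variation u (y s) (v s)) s

theorem variation_smul (u : Fin 5 → ℝ) (y v : E3) (c : ℝ) :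
    variation u y (c • v) = c • variation u y v := by
  ext i; fin_cases i <;> simp [variation] <;> ring

/-- Normalizing projects the scaled derivative off the current direction, and linearity of
`variation` absorbs the factor `‖v‖⁻¹`; this is exactly the `(1 - z ⊗ z)` term of the lift. -/
theorem IsTrajectory.hasVelocityAt {u : Fin 5 → ℝ} {y v : ℝ → E3} (h : IsTrajectory u y v)
    (s : ℝ) : HasVelocityAt (fun r => state (y r) (v r))
      (controlledField u (state (y s) (v s))) s := by
  rw [state, controlledField_apply]
  refine ⟨⟨y, .of_forall fun _ => rfl, (h s).2.1⟩, ?_⟩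
  have := hasDerivAt_direction (fun r => (h r).1) (h s).2.2
  rwa [← variation_smul, ← direction_coe (h s).1] at this

theorem continuous_toTorus : Continuous toTorus := by
  unfold toTorus
  have := Real.Angle.continuous_coe
  fun_prop

theorem IsTrajectory.continuous {u : Fin 5 → ℝ} {y v : ℝ → E3} (h : IsTrajectory u y v) :
    Continuous fun r => state (y r) (v r) := by
  have hy : Continuous y := continuous_iff_continuousAt.2 fun s => (h s).2.1.continuousAt
  refine (continuous_toTorus.comp hy).prodMk (continuous_induced_rng.2 ?_)
  exact continuous_iff_continuousAt.2 fun s =>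
    (hasDerivAt_direction (fun r => (h r).1) (h s).2.2).continuousAt

/-! ### Concatenation of trajectories and reachability -/

/-- `Path w w' t`: a concatenation of finitely many trajectories leads from `w` to `w'` in
time `t`. -/
inductive Path : ST3 → ST3 → ℝ → Prop
  | refl (w : ST3) : Path w w 0
  | snoc {w : ST3} {t t' : ℝ} {u : Fin 5 → ℝ} {y v : ℝ → E3} :
      Path w (state (y 0) (v 0)) t → 0 < t' → IsTrajectory u y v →
        Path w (state (y t') (v t')) (t + t')

theorem Path.trans {w₁ w₂ w₃ : ST3} {s t : ℝ} (h : Path w₁ w₂ s) (h' : Path w₂ w₃ t) :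
    Path w₁ w₃ (s + t) := by
  induction h' with
  | refl => simpa using h
  | snoc _ ht hT ih => rw [← add_assoc]; exact ih.snoc ht hT

theorem IsTrajectory.path {u : Fin 5 → ℝ} {y v : ℝ → E3} (h : IsTrajectory u y v) {t : ℝ}
    (ht : 0 < t) : Path (state (y 0) (v 0)) (state (y t) (v t)) t := by
  simpa using (Path.refl _).snoc ht h

theorem Path.nonneg {w w' : ST3} {t : ℝ} (h : Path w w' t) : 0 ≤ t := by
  induction h with
  | refl => exact le_rfl
  | snoc _ ht _ ih => exact add_nonneg ih ht.le

theorem HasVelocityAt.congr {η ζ : ℝ → ST3} {u : E3 × E3} {s : ℝ} (h : HasVelocityAt η u s)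
    (e : ζ =ᶠ[nhds s] η) : HasVelocityAt ζ u s := by
  obtain ⟨⟨ξ, h1, h2⟩, h3⟩ := h
  refine ⟨⟨ξ, ?_, h2⟩, h3.congr_of_eventuallyEq ?_⟩
  · filter_upwards [h1, e] with r hr he
    rw [hr, he]
  · filter_upwards [e] with r he
    rw [he]

theorem HasVelocityAt.comp_sub_const {η : ℝ → ST3} {u : E3 × E3} {s t : ℝ}
    (h : HasVelocityAt η u (s - t)) : HasVelocityAt (fun r => η (r - t)) u s := by
  obtain ⟨⟨ξ, h1, h2⟩, h3⟩ := h
  have hc : Filter.Tendsto (fun r : ℝ => r - t) (nhds s) (nhds (s - t)) :=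
    (continuous_id.sub continuous_const).continuousAt
  exact ⟨⟨fun r => ξ (r - t), hc.eventually h1, h2.comp_sub_const s t⟩, h3.comp_sub_const s t⟩

theorem IsIntegralCurve.snoc {F : Set (ST3 → E3 × E3)} {η ζ : ℝ → ST3} {t t' : ℝ}
    {V : ST3 → E3 × E3} (h : IsIntegralCurve F η t) (ht : 0 ≤ t) (ht' : 0 < t') (hV : V ∈ F)
    (hζ : Continuous ζ) (hv : ∀ s, HasVelocityAt ζ (V (ζ s)) s) (h0 : η t = ζ 0) :
    IsIntegralCurve F (fun s => if s ≤ t then η s else ζ (s - t)) (t + t') := by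
  obtain ⟨hc, m, τ, W, hτ, hτ0, hτl, hW⟩ := h
  constructor
  · have e : Set.Icc 0 (t + t') = Set.Icc 0 t ∪ Set.Icc t (t + t') :=
      (Set.Icc_union_Icc_eq_Icc ht (by linarith)).symm
    rw [e]
    refine ContinuousOn.union_of_isClosed ?_ ?_ isClosed_Icc isClosed_Icc
    · exact hc.congr fun s hs => if_pos hs.2
    · have : Continuous fun s => ζ (s - t) := by fun_prop
      refine this.continuousOn.congr fun s hs => ?_
      rcases hs.1.eq_or_lt with rfl | hlt
      · simp [h0]
      · exact if_neg hlt.not_ge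
  · refine ⟨m + 1, Fin.snoc (α := fun _ => ℝ) τ (t + t'), Fin.snoc (α := fun _ => ST3 → E3 × E3) W V,
      ?_, ?_, ?_, ?_⟩
    · rw [Fin.strictMono_iff_lt_succ]
      intro i
      induction i using Fin.lastCases with
      | last => simp [hτl, ht']
      | cast i =>
        rw [Fin.succ_castSucc, Fin.snoc_castSucc, Fin.snoc_castSucc]
        exact hτ i.castSucc_lt_succ
    · rw [← Fin.castSucc_zero, Fin.snoc_castSucc, hτ0]
    · simp
    · intro i
      induction i using Fin.lastCases with
      | last =>
        refine ⟨by simpa using hV, fun s hs => ?_⟩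
        simp only [Fin.snoc_castSucc, hτl] at hs
        have hs1 : t < s := hs.1
        simp only [Fin.snoc_last, if_neg hs1.not_ge]
        refine (hv (s - t)).comp_sub_const.congr ?_
        filter_upwards [lt_mem_nhds hs1] with r hr
        exact if_neg hr.not_ge
      | cast i =>
        refine ⟨by simpa using (hW i).1, fun s hs => ?_⟩
        rw [Fin.succ_castSucc, Fin.snoc_castSucc, Fin.snoc_castSucc] at hs
        have hs1 : s < t := hs.2.trans_le (hτl ▸ hτ.monotone (Fin.le_last _))
        simp only [Fin.snoc_castSucc, if_pos hs1.le]
        refine ((hW i).2 s hs).congr ?_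
        filter_upwards [gt_mem_nhds hs1] with r hr
        exact if_pos hr.le

theorem Path.mem_reachableSet {w w' : ST3} {t : ℝ} (h : Path w w' t) :
    w' ∈ reachableSet controlFamily w t := by
  induction h with
  | refl =>
    refine ⟨fun _ => w, ⟨continuousOn_const, 0, fun _ => 0, Fin.elim0, ?_, rfl, rfl,
      fun i => i.elim0⟩, rfl, rfl⟩
    exact fun i j hij => absurd (Subsingleton.elim (α := Fin 1) i j) hij.ne
  | @snoc t t' u y v h ht hT ih =>
    obtain ⟨η, h1, h2, h3⟩ := ih
    refine ⟨_, h1.snoc h.nonneg ht (controlledField_mem u) hT.continuous hT.hasVelocityAt h3,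
      ?_, ?_⟩
    · simp [h.nonneg, h2]
    · simp [ht]

/-! ### Time reversal -/

/-- The involution of the sphere bundle that reverses the horizontal direction of motion. -/
def flip (w : ST3) : ST3 := (w.1 + toTorus !₂[0, 0, Real.pi], w.2)

theorem flip_state (y v : E3) : flip (state y v) = state (y + !₂[0, 0, Real.pi]) v := by
  simp [flip, state, toTorus_add]

theorem flip_flip (w : ST3) : flip (flip w) = w := by
  ext1
  · rw [flip, flip, add_assoc, ← toTorus_add]
    ext i
    fin_cases i <;> simp [toTorus]
  · rfl

/-- Shifting x₃ by π changes the sign of its cosine and sine. The turning rate `1 + field` must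
change sign too: negating `u` and subtracting 2 from the uniform mode does this, and it also negates
the field gradient in `variation`. -/
theorem IsTrajectory.reverse {u : Fin 5 → ℝ} {y v : ℝ → E3} (h : IsTrajectory u y v) (t : ℝ) :
    IsTrajectory (-u + Pi.single 0 (-2)) (fun s => y (t - s) + !₂[0, 0, Real.pi])
      (fun s => v (t - s)) := by
  intro s
  obtain ⟨h0, h1, h2⟩ := h (t - s)
  refine ⟨h0, ?_, ?_⟩
  · refine ((h1.comp_const_sub t s).add_const _).congr_deriv ?_
    ext i
    fin_cases i <;> simp [velocity, field]
    ring
  · refine (h2.comp_const_sub t s).congr_deriv ?_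
    ext i
    fin_cases i <;> simp [variation]
    ring

theorem Path.reverse {w w' : ST3} {t : ℝ} (h : Path w w' t) : Path (flip w') (flip w) t := by
  induction h with
  | refl => exact .refl _
  | @snoc t t' u y v h ht hT ih =>
    rw [add_comm]
    refine Path.trans ?_ ih
    have := (hT.reverse t').path ht
    simpa [flip_state] using this

/-! ### Explicit trajectories -/

theorem path_arc {a b c p q r ω t : ℝ} (hv : p ≠ 0 ∨ q ≠ 0 ∨ r ≠ 0) (hω : ω ≠ 0) (ht : 0 < t) :
    Path (state !₂[a, b, c] !₂[p, q, r])
      (state !₂[a + (Real.sin (c + ω * t) - Real.sin c) / ω,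
          b - (Real.cos (c + ω * t) - Real.cos c) / ω, c + ω * t]
        !₂[p + r * ((Real.cos (c + ω * t) - Real.cos c) / ω),
          q + r * ((Real.sin (c + ω * t) - Real.sin c) / ω), r]) t := by
  have hT : IsTrajectory ![ω - 1, 0, 0, 0, 0]
      (fun t => !₂[a + (Real.sin (c + ω * t) - Real.sin c) / ω,
          b - (Real.cos (c + ω * t) - Real.cos c) / ω, c + ω * t])
      (fun t => !₂[p + r * ((Real.cos (c + ω * t) - Real.cos c) / ω),
          q + r * ((Real.sin (c + ω * t) - Real.sin c) / ω), r]) := by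
    intro s
    have hl : HasDerivAt (fun s : ℝ => c + ω * s) ω s := by
      simpa using ((hasDerivAt_id s).const_mul ω).const_add c
    have hs := (hl.sin.sub_const (Real.sin c)).div_const ω
    have hc := (hl.cos.sub_const (Real.cos c)).div_const ω
    rw [mul_div_cancel_right₀ _ hω] at hs hc
    refine ⟨fun h => ?_, hasDerivAt_e3.2 ⟨?_, ?_, ?_⟩, hasDerivAt_e3.2 ⟨?_, ?_, ?_⟩⟩
    · have h0 := congrArg (fun v : E3 => v 0) h
      have h1 := congrArg (fun v : E3 => v 1) h
      have h2 := congrArg (fun v : E3 => v 2) h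
      simp at h0 h1 h2
      subst h2
      simp at h0 h1
      simp [h0, h1] at hv
    · simpa [velocity] using hs.const_add a
    · simpa [velocity] using hc.const_sub b
    · simpa [velocity, field] using hl
    · simpa [variation, mul_comm] using (hc.const_mul r).const_add p
    · simpa [variation, mul_comm] using (hs.const_mul r).const_add q
    · simpa [variation] using hasDerivAt_const s r
  simpa using hT.path ht

theorem path_straight {a b c p q t : ℝ} (hv : p ≠ 0 ∨ q ≠ 0) (ht : 0 < t) :
    Path (state !₂[a, b, c] !₂[p, q, 0])
      (state !₂[a + Real.cos c * t, b + Real.sin c * t, c] !₂[p, q, 0]) t := by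
  have hT : IsTrajectory ![-1, 0, 0, 0, 0]
      (fun t => !₂[a + Real.cos c * t, b + Real.sin c * t, c]) (fun _ => !₂[p, q, 0]) := by
    intro s
    refine ⟨fun h => ?_, hasDerivAt_e3.2 ⟨?_, ?_, ?_⟩, hasDerivAt_e3.2 ⟨?_, ?_, ?_⟩⟩
    · have h0 := congrArg (fun v : E3 => v 0) h
      have h1 := congrArg (fun v : E3 => v 1) h
      simp at h0 h1
      simp [h0, h1] at hv
    · simpa [velocity] using ((hasDerivAt_id s).const_mul (Real.cos c)).const_add a
    · simpa [velocity] using ((hasDerivAt_id s).const_mul (Real.sin c)).const_add b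
    · simpa [velocity, field] using hasDerivAt_const s c
    · simpa [variation] using hasDerivAt_const s p
    · simpa [variation] using hasDerivAt_const s q
    · simpa [variation] using hasDerivAt_const s (0 : ℝ)
  simpa using hT.path ht

theorem rotation_eq_zero {q r s : ℝ} (h : q * Real.cos s + r * Real.sin s = 0)
    (h' : r * Real.cos s - q * Real.sin s = 0) : q = 0 ∧ r = 0 := by
  have := Real.sin_sq_add_cos_sq s
  constructor
  · linear_combination h * Real.cos s - h' * Real.sin s - q * this
  · linear_combination h * Real.sin s + h' * Real.cos s - r * this

theorem hasDerivAt_rotation (q r s : ℝ) :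
    HasDerivAt (fun s => q * Real.cos s + r * Real.sin s) (r * Real.cos s - q * Real.sin s) s :=
  (((Real.hasDerivAt_cos s).const_mul q).add ((Real.hasDerivAt_sin s).const_mul r)).congr_deriv
    (by ring)

/-- With this control the turning rate is -sin(x₂ - b). It vanishes on x₂ = b with slope -1, so the
particle stays on that line while its tangent vector obeys the harmonic oscillator in the last two
components. -/
theorem path_rotate_first {a b p q r t : ℝ} (hv : p ≠ 0 ∨ q ≠ 0 ∨ r ≠ 0) (ht : 0 < t) :
    Path (state !₂[a, b, 0] !₂[p, q, r])
      (state !₂[a + t, b, 0] !₂[p, q * Real.cos t + r * Real.sin t,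
        r * Real.cos t - q * Real.sin t]) t := by
  have hT : IsTrajectory ![-1, 0, 0, -Real.cos b, Real.sin b]
      (fun t => !₂[a + t, b, 0])
      (fun t => !₂[p, q * Real.cos t + r * Real.sin t,
        r * Real.cos t - q * Real.sin t]) := by
    intro s
    refine ⟨fun h => ?_, hasDerivAt_e3.2 ⟨?_, ?_, ?_⟩, hasDerivAt_e3.2 ⟨?_, ?_, ?_⟩⟩
    · have h0 := congrArg (fun v : E3 => v 0) h
      have h1 := congrArg (fun v : E3 => v 1) h
      have h2 := congrArg (fun v : E3 => v 2) h
      simp at h0 h1 h2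
      obtain ⟨rfl, rfl⟩ := rotation_eq_zero h1 h2
      simp [h0] at hv
    · simpa [velocity] using (hasDerivAt_id s).const_add a
    · simpa [velocity] using hasDerivAt_const s b
    · refine (hasDerivAt_const s (0 : ℝ)).congr_deriv ?_
      simp [velocity, field]
      ring
    · simpa [variation] using hasDerivAt_const s p
    · simpa [variation] using hasDerivAt_rotation q r s
    · have := hasDerivAt_rotation r (-q) s
      simp only [neg_mul, ← sub_eq_add_neg] at this
      refine this.congr_deriv ?_
      simp [variation]
      linear_combination (q * Real.cos s + r * Real.sin s) * Real.sin_sq_add_cos_sq b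
  simpa using hT.path ht

/-- Here the turning rate is sin(x₁ - a), zero on x₁ = a with slope 1, which couples the first and
third components. -/
theorem path_rotate_second {a b p q r t : ℝ} (hv : p ≠ 0 ∨ q ≠ 0 ∨ r ≠ 0) (ht : 0 < t) :
    Path (state !₂[a, b, Real.pi / 2] !₂[p, q, r])
      (state !₂[a, b + t, Real.pi / 2] !₂[p * Real.cos t - r * Real.sin t, q,
        r * Real.cos t + p * Real.sin t]) t := by
  have hT : IsTrajectory ![-1, Real.cos a, -Real.sin a, 0, 0]
      (fun t => !₂[a, b + t, Real.pi / 2])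
      (fun t => !₂[p * Real.cos t - r * Real.sin t, q,
        r * Real.cos t + p * Real.sin t]) := by
    intro s
    refine ⟨fun h => ?_, hasDerivAt_e3.2 ⟨?_, ?_, ?_⟩, hasDerivAt_e3.2 ⟨?_, ?_, ?_⟩⟩
    · have h0 := congrArg (fun v : E3 => v 0) h
      have h1 := congrArg (fun v : E3 => v 1) h
      have h2 := congrArg (fun v : E3 => v 2) h
      simp at h0 h1 h2
      obtain ⟨rfl, rfl⟩ := rotation_eq_zero h2 h0
      simp [h1] at hv
    · simpa [velocity] using hasDerivAt_const s a
    · simpa [velocity] using (hasDerivAt_id s).const_add b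
    · refine (hasDerivAt_const s (Real.pi / 2)).congr_deriv ?_
      simp [velocity, field]
      ring
    · have := hasDerivAt_rotation p (-r) s
      simp only [neg_mul, ← sub_eq_add_neg] at this
      refine this.congr_deriv ?_
      simp [variation]
      ring
    · simpa [variation] using hasDerivAt_const s q
    · refine (hasDerivAt_rotation r p s).congr_deriv ?_
      simp [variation]
      linear_combination (-p * Real.cos s + r * Real.sin s) * Real.sin_sq_add_cos_sq a
  simpa using hT.path ht

/-! ### Steering to, along and from the first axis -/

theorem exists_polar (p q : ℝ) :
    ∃ ρ α : ℝ, 0 ≤ ρ ∧ |α| ≤ Real.pi ∧ p = ρ * Real.cos α ∧ q = ρ * Real.sin α :=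
  ⟨‖(⟨p, q⟩ : ℂ)‖, Complex.arg ⟨p, q⟩, norm_nonneg _, Complex.abs_arg_le_pi _,
    by rw [Complex.norm_mul_cos_arg], by rw [Complex.norm_mul_sin_arg]⟩

theorem exists_state (w : ST3) : ∃ y : E3, ∃ v : E3, v ≠ 0 ∧ w = state y v := by
  have h : ∀ θ : Real.Angle, ∃ x : ℝ, (x : Real.Angle) = θ :=
    fun θ => θ.induction_on fun x => ⟨x, rfl⟩
  choose f hf using h
  refine ⟨WithLp.toLp 2 fun i => f (w.1 i), w.2, ?_, ?_⟩
  · rw [← norm_ne_zero_iff]; simp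
  · ext1
    · funext i; simp [state, toTorus, hf]
    · exact (direction_of_sphere w.2).symm

theorem eq_toLp (y : E3) : y = !₂[y 0, y 1, y 2] := by
  ext i; fin_cases i <;> rfl

theorem exists_angle_eq (θ : Real.Angle) (c : ℝ) :
    ∃ x : ℝ, (x : Real.Angle) = θ ∧ c < x ∧ x ≤ c + 2 * Real.pi := by
  induction θ using Real.Angle.induction_on with | _ x
  refine ⟨toIocMod Real.two_pi_pos c x, ?_, toIocMod_mem_Ioc Real.two_pi_pos c x⟩
  exact Real.Angle.coe_toIocMod x c

theorem state_congr {a b c a' b' c' : ℝ} (v : E3) (ha : (a : Real.Angle) = a')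
    (hb : (b : Real.Angle) = b') (hc : (c : Real.Angle) = c') :
    state !₂[a, b, c] v = state !₂[a', b', c'] v := by
  ext1
  · funext i; fin_cases i <;> simp [state, toTorus, ha, hb, hc]
  · rfl

/-- Every state can be steered in bounded time to one whose direction is the first axis. -/
theorem exists_path_to_axis (w : ST3) : ∃ a b c t : ℝ, t ≤ 40 ∧
    Path w (state !₂[a, b, c] !₂[1, 0, 0]) t := by
  have hpi := Real.pi_pos
  obtain ⟨y, v, hv, rfl⟩ := exists_state w
  -- A representative in (-4π, -2π] is nonzero, so x₃ can be turned to 0 in unit time at the nonzero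
  -- rate -c.
  obtain ⟨c, hc, hc0, hc1⟩ := exists_angle_eq ((y 2 : ℝ) : Real.Angle) (-(4 * Real.pi))
  have hc2 : -c ≠ 0 := by linarith
  have hne : v 0 ≠ 0 ∨ v 1 ≠ 0 ∨ v 2 ≠ 0 := by
    by_contra! h
    exact hv (by rw [eq_toLp v, h.1, h.2.1, h.2.2]; ext i; fin_cases i <;> rfl)
  -- turn to the first coordinate direction
  obtain ⟨a₁, b₁, p₁, q₁, r₁, hne₁, h₁⟩ : ∃ a₁ b₁ p₁ q₁ r₁ : ℝ, (p₁ ≠ 0 ∨ q₁ ≠ 0 ∨ r₁ ≠ 0) ∧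
      Path (state y v) (state !₂[a₁, b₁, 0] !₂[p₁, q₁, r₁]) 1 := by
    have h := path_arc (a := y 0) (b := y 1) (c := c) hne hc2 one_pos
    rw [state_congr _ rfl rfl hc, ← eq_toLp, ← eq_toLp, mul_one, add_neg_cancel] at h
    refine ⟨_, _, _, _, _, ?_, h⟩
    rcases eq_or_ne (v 2) 0 with h2 | h2
    · simpa [h2] using hne
    · exact .inr (.inr h2)
  -- rotate the direction so that the following quarter turn annihilates its second component
  obtain ⟨ρ, α, -, hα, hp, hq⟩ := exists_polar (q₁ + r₁) (r₁ - q₁)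
  rw [abs_le] at hα
  have h₂ := path_rotate_first (a := a₁) (b := b₁) hne₁
    (show 0 < α + 3 * Real.pi / 2 by linarith)
  obtain ⟨r₂, hr₂⟩ : ∃ r₂, r₂ = r₁ * Real.cos (α + 3 * Real.pi / 2) -
    q₁ * Real.sin (α + 3 * Real.pi / 2) := ⟨_, rfl⟩
  have hq₂ : q₁ * Real.cos (α + 3 * Real.pi / 2) + r₁ * Real.sin (α + 3 * Real.pi / 2) = -r₂ := by
    have e : α + 3 * Real.pi / 2 = α - Real.pi / 2 + 2 * Real.pi := by ring
    rw [hr₂, e, Real.cos_add_two_pi, Real.sin_add_two_pi, Real.cos_sub_pi_div_two,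
      Real.sin_sub_pi_div_two]
    linear_combination Real.sin α * hp - Real.cos α * hq
  have hne₂ : p₁ ≠ 0 ∨ -r₂ ≠ 0 ∨ r₂ ≠ 0 := by
    by_contra! h
    obtain ⟨rfl, rfl⟩ := rotation_eq_zero (hq₂.trans h.2.1) (hr₂.symm.trans h.2.2)
    simp [h.1] at hne₁
  rw [hq₂, ← hr₂] at h₂
  -- turn to the second coordinate direction
  have h₃ := path_arc (a := a₁ + (α + 3 * Real.pi / 2)) (b := b₁) (c := 0) hne₂ one_ne_zero
    (half_pos hpi)
  simp only [zero_add, one_mul, Real.sin_pi_div_two, Real.cos_pi_div_two, Real.sin_zero,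
    Real.cos_zero, div_one, zero_sub, sub_zero, mul_one, neg_add_cancel, mul_neg] at h₃
  have hne₃ : p₁ + -r₂ ≠ 0 ∨ (0 : ℝ) ≠ 0 ∨ r₂ ≠ 0 := by
    rcases eq_or_ne r₂ 0 with h | h
    · simpa [h] using hne₂
    · exact .inr (.inr h)
  -- rotate the direction to the first axis
  obtain ⟨σ, β, hσ, hβ, hP, hR⟩ := exists_polar (p₁ + -r₂) r₂
  rw [abs_le] at hβ
  -- Rotation by -β is needed; adding 2π makes the time positive.
  have h₄ := path_rotate_second (a := a₁ + (α + 3 * Real.pi / 2) + 1) (b := b₁ - -1) hne₃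
    (show 0 < 2 * Real.pi - β by linarith)
  have hσ0 : 0 < σ := by
    refine hσ.lt_of_ne ?_
    rintro rfl
    simp only [zero_mul] at hP hR
    rcases hne₃ with h | h | h
    exacts [h hP, h rfl, h hR]
  have e : ∀ b c : ℝ, state !₂[a₁ + (α + 3 * Real.pi / 2) + 1, b, c] !₂[σ, 0, 0] =
      state !₂[a₁ + (α + 3 * Real.pi / 2) + 1, b, c] !₂[1, 0, 0] := by
    intro b c
    have : (!₂[σ, 0, 0] : E3) = σ • !₂[1, 0, 0] := by ext i; fin_cases i <;> simp
    rw [state, this, direction_smul hσ0, state]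
  rw [Real.cos_two_pi_sub, Real.sin_two_pi_sub,
    show (p₁ + -r₂) * Real.cos β - r₂ * -Real.sin β = σ by
      linear_combination Real.cos β * hP + Real.sin β * hR + σ * Real.sin_sq_add_cos_sq β,
    show r₂ * Real.cos β + (p₁ + -r₂) * -Real.sin β = 0 by
      linear_combination Real.cos β * hR - Real.sin β * hP, e] at h₄
  refine ⟨_, _, _, _, ?_, h₁.trans (h₂.trans (h₃.trans h₄))⟩
  linarith [Real.pi_lt_four, Real.pi_lt_d2]

theorem exists_path_turn (c c' : ℝ) : ∃ dx dy : ℝ, ∀ a b : ℝ,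
    Path (state !₂[a, b, c] !₂[1, 0, 0]) (state !₂[a + dx, b + dy, c'] !₂[1, 0, 0]) 1 := by
  obtain ⟨x, hx, hlt, -⟩ := exists_angle_eq (c' : Real.Angle) c
  refine ⟨(Real.sin x - Real.sin c) / (x - c), -((Real.cos x - Real.cos c) / (x - c)),
    fun a b => ?_⟩
  have h := path_arc (a := a) (b := b) (c := c) (p := 1) (q := 0) (r := 0) (.inl one_ne_zero)
    (sub_pos.2 hlt).ne' one_pos
  rw [mul_one, add_sub_cancel, state_congr (c := x) _ rfl rfl hx] at h
  simpa [sub_eq_add_neg] using h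

/-- States with the first axis as direction can be steered to each other in any large time. -/
theorem path_axis (a b c a' b' c' : ℝ) {t : ℝ} (ht : 20 ≤ t) :
    Path (state !₂[a, b, c] !₂[1, 0, 0]) (state !₂[a', b', c'] !₂[1, 0, 0]) t := by
  have hpi := Real.pi_pos
  have hpi' := Real.pi_lt_four
  obtain ⟨x₁, y₁, h₁⟩ := exists_path_turn c 0
  obtain ⟨x₂, y₂, h₂⟩ := exists_path_turn 0 (Real.pi / 2)
  obtain ⟨x₃, y₃, h₃⟩ := exists_path_turn (Real.pi / 2) c'
  obtain ⟨s, hs, hs0, hs1⟩ := exists_angle_eq ((a' - a - x₁ - x₂ - x₃ : ℝ) : Real.Angle) 0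
  obtain ⟨s', hs', hs0', hs1'⟩ := exists_angle_eq ((b' - b - y₁ - y₂ - y₃ : ℝ) : Real.Angle) 0
  have hT : 0 < t - 3 - s - s' := by linarith [Real.pi_lt_d2]
  -- One full circle uses up the spare time and returns to the start. The other moves take at most 3
  -- + 4π < 20.
  have h₀ := path_arc (a := a) (b := b) (c := c) (p := 1) (q := 0) (r := 0) (.inl one_ne_zero)
    (div_ne_zero (Real.two_pi_pos).ne' hT.ne') hT
  rw [div_mul_cancel₀ _ hT.ne', Real.sin_add_two_pi, Real.cos_add_two_pi] at h₀
  simp only [sub_self, zero_div, add_zero, sub_zero, mul_zero] at h₀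
  rw [state_congr (c := c + 2 * Real.pi) (c' := c) _ rfl rfl (by simp)] at h₀
  have h₄ := path_straight (a := a + x₁) (b := b + y₁) (c := 0) (p := 1) (q := 0)
    (.inl one_ne_zero) hs0
  have h₅ := path_straight (a := a + x₁ + s + x₂) (b := b + y₁ + y₂) (c := Real.pi / 2) (p := 1)
    (q := 0) (.inl one_ne_zero) hs0'
  simp only [Real.cos_zero, Real.sin_zero, Real.cos_pi_div_two, Real.sin_pi_div_two, one_mul,
    zero_mul, add_zero] at h₄ h₅
  have h := h₀.trans ((h₁ _ _).trans (h₄.trans ((h₂ _ _).trans (h₅.trans (h₃ _ _)))))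
  rw [state_congr (a' := a') (b' := b') (c' := c') _ ?_ ?_ rfl] at h
  · convert h using 1
    ring
  · rw [Real.Angle.coe_add, Real.Angle.coe_add, Real.Angle.coe_add, Real.Angle.coe_add, hs]
    simp only [← Real.Angle.coe_add]
    congr 1
    ring
  · rw [Real.Angle.coe_add, Real.Angle.coe_add, hs']
    simp only [← Real.Angle.coe_add]
    congr 1
    ring

theorem path_all (w w' : ST3) : Path w w' 100 := by
  obtain ⟨a, b, c, t, ht, h⟩ := exists_path_to_axis w
  -- Reversing a path from `flip w'` to the axis yields one from the axis to `w'`. The two ends cost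
  -- at most 40 each, leaving at least 20 for `path_axis`.
  obtain ⟨a', b', c', t', ht', h'⟩ := exists_path_to_axis (flip w')
  have h2 := h'.reverse
  rw [flip_flip, flip_state, eq_toLp (_ + _)] at h2
  convert h.trans ((path_axis a b c _ _ _ (t := 100 - t - t') (by linarith)).trans h2) using 1
  ring

end

end ChargedParticle

theorem mainTheorem5 :
    ∃ T' : ℝ, 0 < T' ∧ ∀ w : ChargedParticle.ST3,
      closure (ChargedParticle.reachableSet ChargedParticle.controlFamily w T') = Set.univ :=
  ⟨100, by norm_num, fun w => Set.eq_univ_of_forall fun w' =>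
    subset_closure (ChargedParticle.path_all w w').mem_reachableSet⟩
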